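/- Consider the following fifteen sporadic Apéry-like sequences of integers, indexed by $n\ge 0$ (sums without limits run over all integers $k,l\ge 0$ for which the terms are nonzero, with $\binom{m}{j}=0$ for integers $0\le m<j$): - (a) $\sum_k \binom{n}{k}^3$ - (b) $\sum_k \binom{n}{k}^2\binom{n+k}{n}$ - (c) $\sum_k \binom{n}{k}^2\binom{2k}{k}$ - (d) $\sum_k \binom{n}{k}\binom{2k}{k}\binom{2(n-k)}{n-k}$ - (f) $\sum_k (-1)^k 3^{n-3k}\binom{n}{3k}\frac{(3k)!}{k!^3}$ - (g) $\sum_{k,l} (-1)^k 8^{n-k}\binom{n}{k}\binom{k}{l}^3$ - ($\delta$) $\sum_k (-1)^k 3^{n-3k}\binom{n}{3k}\binom{n+k}{n}\frac{(3k)!}{k!^3}$ - ($\eta$) $\sum_{k=0}^{\lfloor n/5\rfloor} (-1)^k \binom{n}{k}^3\left(\binom{4n-5k-1}{3n}+\binom{4n-5k}{3n}\right)$ for $n\ge 1$, with value $1$ at $n=0$ - ($\alpha$) $\sum_k \binom{n}{k}^2\binom{2k}{k}\binom{2(n-k)}{n-k}$ - ($\epsilon$) $\sum_k \binom{n}{k}^2\binom{2k}{n}^2$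 - ($\zeta$) $\sum_{k,l} \binom{n}{k}^2\binom{n}{l}\binom{k}{l}\binom{k+l}{n}$ - ($\gamma$) $\sum_k \binom{n}{k}^2\binom{n+k}{n}^2$ - $s_7$: $\sum_k \binom{n}{k}^2\binom{n+k}{k}\binom{2k}{n}$ - $s_{10}$: $\sum_k \binom{n}{k}^4$ - $s_{18}$: $\sum_{k=0}^{\lfloor n/3\rfloor} (-1)^k \binom{n}{k}\binom{2k}{k}\binom{2(n-k)}{n-k}\left(\binom{2n-3k-1}{n}+\binom{2n-3k}{n}\right)$ for $n\ge 1$, with $s_{18}(0)=1$ Let $C(n)$ be any of these fifteen sequences. Then: 1. $C(n)\equiv C(1) \pmod 2$ for all $n\ge 1$. 2. $C(n)\equiv C(1)\pmod 3$ for all $n\ge 1$ if $C$ is one of (c), (f), (g), ($\delta$), ($\alpha$), ($\epsilon$), ($\zeta$), $s_{18}$; and $C(n)\equiv (-1)^n \pmod 3$ for all $n\ge 0$ if $C$ is (a) or ($\gamma$). 3. $C(n)\equiv 3^n\pmod 5$ for all $n\ge 0$ if $C$ is (b); and $C(n)\equiv 0\pmod 5$ for all $n\ge 1$ if $C$ is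 ($\eta$). -/

import Mathlib

open scoped Nat

namespace AperyLike

/-!  The fifteen sporadic Apéry-like sequences, through their binomial sums, as integer sequences.
The sums over all `k` (and `l`) are written over the range outside of which the summands vanish. -/

/-- Ensures that the natural-number quotient `(3k)! / k!³` in sequences (f) and (δ) is exact. -/
theorem factorial_pow_three_dvd (k : ℕ) : k ! ^ 3 ∣ (3 * k)! := by
  have h := Nat.prod_factorial_dvd_factorial_sum (Finset.univ : Finset (Fin 3)) (fun _ => k)
  simpa using h

/-- Sequence (a), the Franel numbers. -/
def seqA (n : ℕ) : ℤ :=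
  ∑ k ∈ Finset.range (n + 1), (n.choose k : ℤ) ^ 3

/-- Sequence (b). -/
def seqB (n : ℕ) : ℤ :=
  ∑ k ∈ Finset.range (n + 1), (n.choose k : ℤ) ^ 2 * ((n + k).choose n : ℤ)

/-- Sequence (c). -/
def seqC (n : ℕ) : ℤ :=
  ∑ k ∈ Finset.range (n + 1), (n.choose k : ℤ) ^ 2 * ((2 * k).choose k : ℤ)

/-- Sequence (d). -/
def seqD (n : ℕ) : ℤ :=
  ∑ k ∈ Finset.range (n + 1),
    (n.choose k : ℤ) * ((2 * k).choose k : ℤ) * ((2 * (n - k)).choose (n - k) : ℤ)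

/-- Sequence (f); the sum runs over `3k ≤ n`, so the exponent `n - 3k` is not truncated. -/
def seqF (n : ℕ) : ℤ :=
  ∑ k ∈ Finset.range (n / 3 + 1),
    (-1) ^ k * 3 ^ (n - 3 * k) * (n.choose (3 * k) : ℤ) * (((3 * k)! / k ! ^ 3 : ℕ) : ℤ)

/-- Sequence (g). -/
def seqG (n : ℕ) : ℤ :=
  ∑ k ∈ Finset.range (n + 1), ∑ l ∈ Finset.range (k + 1),
    (-1) ^ k * 8 ^ (n - k) * (n.choose k : ℤ) * (k.choose l : ℤ) ^ 3

/-- Sequence (δ), the Almkvist–Zudilin numbers; the sum runs over `3k ≤ n`. -/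
def seqDelta (n : ℕ) : ℤ :=
  ∑ k ∈ Finset.range (n / 3 + 1),
    (-1) ^ k * 3 ^ (n - 3 * k) * (n.choose (3 * k) : ℤ) * ((n + k).choose n : ℤ) *
      (((3 * k)! / k ! ^ 3 : ℕ) : ℤ)

/-- Sequence (η), with initial value `1`. For `n ≥ 1` and `5k ≤ n` one has
`4n - 5k - 1 ≥ 3n - 1 ≥ 0`, so no subtraction is truncated. -/
def seqEta (n : ℕ) : ℤ :=
  if n = 0 then 1 else
    ∑ k ∈ Finset.range (n / 5 + 1),
      (-1) ^ k * (n.choose k : ℤ) ^ 3 *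
        (((4 * n - 5 * k - 1).choose (3 * n) : ℤ) + ((4 * n - 5 * k).choose (3 * n) : ℤ))

/-- Sequence (α), the Domb numbers. -/
def seqAlpha (n : ℕ) : ℤ :=
  ∑ k ∈ Finset.range (n + 1),
    (n.choose k : ℤ) ^ 2 * ((2 * k).choose k : ℤ) * ((2 * (n - k)).choose (n - k) : ℤ)

/-- Sequence (ε). -/
def seqEpsilon (n : ℕ) : ℤ :=
  ∑ k ∈ Finset.range (n + 1), (n.choose k : ℤ) ^ 2 * ((2 * k).choose n : ℤ) ^ 2

/-- Sequence (ζ). -/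
def seqZeta (n : ℕ) : ℤ :=
  ∑ k ∈ Finset.range (n + 1), ∑ l ∈ Finset.range (n + 1),
    (n.choose k : ℤ) ^ 2 * (n.choose l : ℤ) * (k.choose l : ℤ) * ((k + l).choose n : ℤ)

/-- Sequence (γ), the Apéry numbers. -/
def seqGamma (n : ℕ) : ℤ :=
  ∑ k ∈ Finset.range (n + 1), (n.choose k : ℤ) ^ 2 * ((n + k).choose n : ℤ) ^ 2

/-- Cooper's sequence `s₇`. -/
def seqS7 (n : ℕ) : ℤ :=
  ∑ k ∈ Finset.range (n + 1),
    (n.choose k : ℤ) ^ 2 * ((n + k).choose k : ℤ) * ((2 * k).choose n : ℤ)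

/-- The sequence `s₁₀`. -/
def seqS10 (n : ℕ) : ℤ :=
  ∑ k ∈ Finset.range (n + 1), (n.choose k : ℤ) ^ 4

/-- Cooper's sequence `s₁₈`, with initial value `1`. For `n ≥ 1` and `3k ≤ n` one has
`2n - 3k - 1 ≥ n - 1 ≥ 0`, so no subtraction is truncated. -/
def seqS18 (n : ℕ) : ℤ :=
  if n = 0 then 1 else
    ∑ k ∈ Finset.range (n / 3 + 1),
      (-1) ^ k * (n.choose k : ℤ) * ((2 * k).choose k : ℤ) *
        ((2 * (n - k)).choose (n - k) : ℤ) *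
        (((2 * n - 3 * k - 1).choose n : ℤ) + ((2 * n - 3 * k).choose n : ℤ))

/-- The labels of the fifteen sporadic sequences. -/
inductive Label
  | a | b | c | d | f | g
  | delta | eta | alpha | epsilon | zeta | gamma | s7 | s10 | s18

/-- The sporadic Apéry-like sequence with a given label. -/
def seq : Label → ℕ → ℤ
  | .a => seqA
  | .b => seqB
  | .c => seqC
  | .d => seqD
  | .f => seqF
  | .g => seqG
  | .delta => seqDelta
  | .eta => seqEta
  | .alpha => seqAlpha
  | .epsilon => seqEpsilon
  | .zeta => seqZeta
  | .gamma => seqGamma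
  | .s7 => seqS7
  | .s10 => seqS10
  | .s18 => seqS18

end AperyLike

namespace AperyLike

/-! Ten of the sequences satisfy Lucas congruences `S (p * n + r) ≡ S n * S r` modulo every prime
`p`, because their summands factor over base-`p` digits (`IsLucas.of_sum`). The residue of `S n` is
then a product over the digits of `n`, and the claims reduce to the values at `r < p`
(`IsLucas.eq_one`, `IsLucas.eq_pow`).

The other five are treated directly. In (f) and (δ), `(3k)! / k!³` is divisible by 2 and 3 for `k ≥
1`, leaving `3 ^ n`. In (g), cubes modulo 2 and 3 are trivial and the binomial theorem finishes. For
`s₁₈` modulo 3 and (η) modulo 5, the paired binomials cancel when `p ∤ n`, and a descent `p * n → n`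
covers the rest (`cast_eq_zero_of_sum`). Modulo 2, central binomials settle `s₁₈`, and (η) descends
from `n` to `n / 2`. -/

theorem add_sub_add_digits {p n k r s : ℕ} (hk : k ≤ n) (hs : s ≤ r) :
    p * n + r - (p * k + s) = p * (n - k) + (r - s) := by
  have := Nat.mul_le_mul_left p hk
  rw [Nat.mul_sub]
  omega

theorem sum_range_mul_eq {M : Type*} [AddCommMonoid M] (f : ℕ → M) (p n : ℕ) :
    ∑ k ∈ Finset.range (p * n), f k =
      ∑ k ∈ Finset.range n, ∑ s ∈ Finset.range p, f (p * k + s) := by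
  induction n with
  | zero => simp
  | succ n ih => rw [mul_add, mul_one, Finset.sum_range_add, ih, Finset.sum_range_succ]

theorem sum_range_eq_of_le {M : Type*} [AddCommMonoid M] {f : ℕ → M} {a b : ℕ} (hab : a ≤ b)
    (h : ∀ k, a ≤ k → f k = 0) : ∑ k ∈ Finset.range b, f k = ∑ k ∈ Finset.range a, f k := by
  symm
  refine Finset.sum_subset (Finset.range_mono hab) fun k _ hk => h k ?_
  simpa using hk

/-! ### Lucas congruences from digitwise factorization -/

section Lucas

variable {p : ℕ} [hp : Fact p.Prime]

theorem choose_lucas {r s : ℕ} (hr : r < p) (hs : s < p) (n k : ℕ) :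
    ((p * n + r).choose (p * k + s) : ZMod p) = n.choose k * r.choose s := by
  have h := Choose.choose_modEq_choose_mod_mul_choose_div_nat (n := p * n + r) (k := p * k + s)
    (p := p)
  have hp0 := hp.out.pos
  rw [Nat.mul_add_mod, Nat.mul_add_mod, Nat.mod_eq_of_lt hr, Nat.mod_eq_of_lt hs,
    Nat.mul_add_div hp0, Nat.mul_add_div hp0, Nat.div_eq_of_lt hr, Nat.div_eq_of_lt hs,
    ← ZMod.natCast_eq_natCast_iff] at h
  rw [h]
  push_cast
  simp [mul_comm]

/-- A carry in `s + t` does no harm: it leaves the digit `d = s + t - p < s ≤ r`, so both sides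
vanish. -/
theorem choose_add_lucas {r s t : ℕ} (hr : r < p) (ht : t < p) (hsr : s ≤ r)
    (n k l : ℕ) :
    ((p * k + s + (p * l + t)).choose (p * n + r) : ZMod p) =
      (k + l).choose n * (s + t).choose r := by
  rcases lt_or_ge (s + t) p with h | h
  · rw [← choose_lucas h hr]
    congr 2
    ring
  · obtain ⟨d, hd⟩ := Nat.exists_eq_add_of_le h
    have hdr : d < r := by omega
    have hdp : d < p := by omega
    have h1 : p * k + s + (p * l + t) = p * (k + l + 1) + d := by
      rw [mul_add, mul_add]; omega
    have h2 := choose_lucas hdp hr 1 0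
    rw [mul_one, mul_zero, zero_add, ← hd] at h2
    rw [h1, choose_lucas hdp hr, h2, Nat.choose_eq_zero_of_lt hdr]
    simp

theorem centralBinom_lucas {s : ℕ} (hs : s < p) (k : ℕ) :
    ((2 * (p * k + s)).choose (p * k + s) : ZMod p) = (2 * k).choose k * (2 * s).choose s := by
  simpa only [two_mul] using choose_add_lucas hs hs le_rfl k k k

theorem choose_mul_lucas (F : ℕ → ℕ → ZMod p) {n k r s : ℕ} (hr : r < p) (hs : s < p)
    (h : k ≤ n → s ≤ r → F (p * n + r) (p * k + s) = F n k * F r s) :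
    ((p * n + r).choose (p * k + s) : ZMod p) * F (p * n + r) (p * k + s) =
      (n.choose k * F n k) * (r.choose s * F r s) := by
  rw [choose_lucas hr hs]
  rcases lt_or_ge n k with h1 | h1
  · simp [Nat.choose_eq_zero_of_lt h1]
  rcases lt_or_ge r s with h2 | h2
  · simp [Nat.choose_eq_zero_of_lt h2]
  rw [h h1 h2]
  ring

/-- `S` satisfies the Lucas congruences modulo `p`. -/
def IsLucas (p : ℕ) (S : ℕ → ℤ) : Prop :=
  ∀ n r, r < p → (S (p * n + r) : ZMod p) = S n * S r

theorem IsLucas.of_sum {S : ℕ → ℤ} (f : ℕ → ℕ → ZMod p)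
    (hS : ∀ n, (S n : ZMod p) = ∑ k ∈ Finset.range (n + 1), n.choose k * f n k)
    (hf : ∀ n k r s, r < p → s < p → k ≤ n → s ≤ r →
      f (p * n + r) (p * k + s) = f n k * f r s) : IsLucas p S := by
  intro n r hr
  have hv : ∀ n k : ℕ, n + 1 ≤ k → (n.choose k * f n k : ZMod p) = 0 := fun n k h => by
    simp [Nat.choose_eq_zero_of_lt (Nat.lt_of_succ_le h)]
  -- Padding with zero terms up to `p * (n + 1)` lets the index run over all digit pairs `p * k +
  -- s`.
  have h1 : p * n + r + 1 ≤ p * (n + 1) := by rw [mul_add]; omega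
  rw [hS, hS, hS, ← sum_range_eq_of_le h1 (hv _), sum_range_mul_eq,
    ← sum_range_eq_of_le (Nat.succ_le_of_lt hr) (hv _), Finset.sum_mul_sum]
  refine Finset.sum_congr rfl fun k _ => Finset.sum_congr rfl fun s hs => ?_
  have hs := Finset.mem_range.1 hs
  exact choose_mul_lucas f hr hs fun h1 h2 => hf n k r s hr hs h1 h2

/-- Each nonzero digit contributes the idempotent `S 1`, each zero digit contributes 1. -/
theorem IsLucas.eq_one {S : ℕ → ℤ} (h : IsLucas p S) (h0 : S 0 = 1)
    (hr : ∀ r, r < p → r ≠ 0 → (S r : ZMod p) = S 1) (h1 : (S 1 : ZMod p) * S 1 = S 1)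
    {n : ℕ} (hn : 1 ≤ n) : S n ≡ S 1 [ZMOD p] := by
  rw [← ZMod.intCast_eq_intCast_iff]
  induction n using Nat.strong_induction_on with
  | _ n ih =>
    have hm : n % p < p := Nat.mod_lt _ hp.out.pos
    have hdm := Nat.div_add_mod n p
    have key := h (n / p) (n % p) hm
    rw [hdm] at key
    rcases Nat.eq_zero_or_pos (n / p) with h2 | h2
    · rw [h2, mul_zero, zero_add] at hdm
      rw [← hdm]
      exact hr _ hm (by omega)
    · rw [key, ih _ (Nat.div_lt_self hn hp.out.one_lt) h2]
      by_cases h3 : n % p = 0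
      · rw [h3, h0]; simp
      · rw [hr _ hm h3, h1]

/-- By Fermat, `c ^ (p * n + r) = c ^ n * c ^ r` modulo `p`, so powers obey the same recursion. -/
theorem IsLucas.eq_pow {S : ℕ → ℤ} (h : IsLucas p S) (c : ℤ) (h0 : S 0 = 1)
    (hr : ∀ r, r < p → (S r : ZMod p) = c ^ r) (n : ℕ) : S n ≡ c ^ n [ZMOD p] := by
  rw [← ZMod.intCast_eq_intCast_iff]
  push_cast
  induction n using Nat.strong_induction_on with
  | _ n ih =>
    have hm : n % p < p := Nat.mod_lt _ hp.out.pos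
    rcases Nat.eq_zero_or_pos n with rfl | hn
    · simp [h0]
    have key := h (n / p) (n % p) hm
    rw [Nat.div_add_mod] at key
    rw [key, ih _ (Nat.div_lt_self hn hp.out.one_lt), hr _ hm]
    conv_rhs => rw [← Nat.div_add_mod n p, pow_add, pow_mul, ZMod.pow_card]

theorem isLucas_seqA : IsLucas p seqA :=
  .of_sum (fun n k => (n.choose k : ZMod p) ^ 2)
    (fun n => by
      simp only [seqA]; push_cast
      exact Finset.sum_congr rfl fun k _ => by ring)
    (fun n k r s hr hs _ _ => by simp only [choose_lucas hr hs]; ring)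

theorem isLucas_seqS10 : IsLucas p seqS10 :=
  .of_sum (fun n k => (n.choose k : ZMod p) ^ 3)
    (fun n => by
      simp only [seqS10]; push_cast
      exact Finset.sum_congr rfl fun k _ => by ring)
    (fun n k r s hr hs _ _ => by simp only [choose_lucas hr hs]; ring)

theorem isLucas_seqB : IsLucas p seqB :=
  .of_sum (fun n k => n.choose k * (n + k).choose n)
    (fun n => by
      simp only [seqB]; push_cast
      exact Finset.sum_congr rfl fun k _ => by ring)
    (fun n k r s hr hs _ _ => by
      simp only [choose_lucas hr hs, choose_add_lucas hr hs le_rfl]; ring)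

theorem isLucas_seqGamma : IsLucas p seqGamma :=
  .of_sum (fun n k => n.choose k * ((n + k).choose n : ZMod p) ^ 2)
    (fun n => by
      simp only [seqGamma]; push_cast
      exact Finset.sum_congr rfl fun k _ => by ring)
    (fun n k r s hr hs _ _ => by
      simp only [choose_lucas hr hs, choose_add_lucas hr hs le_rfl]; ring)

theorem isLucas_seqC : IsLucas p seqC :=
  .of_sum (fun n k => n.choose k * (2 * k).choose k)
    (fun n => by
      simp only [seqC]; push_cast
      exact Finset.sum_congr rfl fun k _ => by ring)
    (fun n k r s hr hs _ _ => by
      simp only [choose_lucas hr hs, centralBinom_lucas hs]; ring)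

theorem isLucas_seqD : IsLucas p seqD :=
  .of_sum (fun n k => (2 * k).choose k * (2 * (n - k)).choose (n - k))
    (fun n => by
      simp only [seqD]; push_cast
      exact Finset.sum_congr rfl fun k _ => by ring)
    (fun n k r s hr hs hk hsr => by
      have hrs : r - s < p := by omega
      simp only [add_sub_add_digits hk hsr, centralBinom_lucas hs, centralBinom_lucas hrs]
      ring)

theorem isLucas_seqAlpha : IsLucas p seqAlpha :=
  .of_sum (fun n k => n.choose k * (2 * k).choose k * (2 * (n - k)).choose (n - k))
    (fun n => by
      simp only [seqAlpha]; push_cast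
      exact Finset.sum_congr rfl fun k _ => by ring)
    (fun n k r s hr hs hk hsr => by
      have hrs : r - s < p := by omega
      simp only [add_sub_add_digits hk hsr, choose_lucas hr hs, centralBinom_lucas hs,
        centralBinom_lucas hrs]
      ring)

theorem choose_two_mul_lucas {r s : ℕ} (hr : r < p) (hs : s < p) (hsr : s ≤ r) (n k : ℕ) :
    ((2 * (p * k + s)).choose (p * n + r) : ZMod p) = (2 * k).choose n * (2 * s).choose r := by
  simpa only [two_mul] using choose_add_lucas hr hs hsr n k k

theorem isLucas_seqEpsilon : IsLucas p seqEpsilon :=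
  .of_sum (fun n k => n.choose k * ((2 * k).choose n : ZMod p) ^ 2)
    (fun n => by
      simp only [seqEpsilon]; push_cast
      exact Finset.sum_congr rfl fun k _ => by ring)
    (fun n k r s hr hs hk hsr => by
      simp only [choose_lucas hr hs, choose_two_mul_lucas hr hs hsr]
      ring)

theorem isLucas_seqS7 : IsLucas p seqS7 :=
  .of_sum (fun n k => n.choose k * (n + k).choose k * (2 * k).choose n)
    (fun n => by
      simp only [seqS7]; push_cast
      exact Finset.sum_congr rfl fun k _ => by ring)
    (fun n k r s hr hs hk hsr => by
      have h := choose_add_lucas hs hr le_rfl k k n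
      rw [add_comm, add_comm k n, add_comm s r] at h
      simp only [choose_lucas hr hs, choose_two_mul_lucas hr hs hsr, h]
      ring)

theorem isLucas_seqZeta : IsLucas p seqZeta := by
  have hv : ∀ n k l : ℕ, n + 1 ≤ l →
      (n.choose l * (k.choose l * (k + l).choose n) : ZMod p) = 0 := fun n k l h => by
    simp [Nat.choose_eq_zero_of_lt (Nat.lt_of_succ_le h)]
  refine .of_sum (fun n k => n.choose k * ∑ l ∈ Finset.range (n + 1),
    (n.choose l * (k.choose l * (k + l).choose n) : ZMod p)) (fun n => ?_)
    fun n k r s hr hs hk hsr => ?_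
  · simp only [seqZeta, Finset.mul_sum]
    push_cast
    exact Finset.sum_congr rfl fun k _ => Finset.sum_congr rfl fun l _ => by ring
  -- The inner sum over `l` factors by the same padding and digit splitting.
  · have h1 : p * n + r + 1 ≤ p * (n + 1) := by rw [mul_add]; omega
    rw [choose_lucas hr hs, ← sum_range_eq_of_le h1 (hv _ _), sum_range_mul_eq,
      ← sum_range_eq_of_le (Nat.succ_le_of_lt hr) (hv _ _), mul_mul_mul_comm, Finset.sum_mul_sum]
    congr 1
    refine Finset.sum_congr rfl fun l _ => Finset.sum_congr rfl fun t ht => ?_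
    have ht := Finset.mem_range.1 ht
    rw [choose_lucas hr ht, choose_lucas hs ht, choose_add_lucas hr ht hsr]
    ring

end Lucas

/-! ### Sequences (f), (δ) and (g) -/

section FactorialSums

theorem two_dvd_choose_two_mul {k : ℕ} (hk : k ≠ 0) : 2 ∣ (2 * k).choose k :=
  Nat.two_dvd_centralBinom_of_one_le (Nat.pos_of_ne_zero hk)

theorem factorial_div_pow_three (k : ℕ) :
    (3 * k)! / k ! ^ 3 = (3 * k).choose k * (2 * k).choose k := by
  have h1 := Nat.add_choose_mul_factorial_mul_factorial (2 * k) k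
  have h2 := Nat.add_choose_mul_factorial_mul_factorial k k
  rw [show 2 * k + k = 3 * k by ring] at h1
  rw [← two_mul] at h2
  refine Nat.div_eq_of_eq_mul_left (by positivity) ?_
  rw [← h1, ← h2]
  ring

theorem three_dvd_choose_three_mul {k : ℕ} (hk : k ≠ 0) : 3 ∣ (3 * k).choose k := by
  obtain ⟨m, rfl⟩ := Nat.exists_eq_succ_of_ne_zero hk
  have h := Nat.add_one_mul_choose_eq (3 * m + 2) m
  refine ⟨(3 * m + 2).choose m, Nat.eq_of_mul_eq_mul_right (Nat.succ_pos m) ?_⟩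
  rw [show 3 * m.succ = 3 * m + 2 + 1 by omega, Nat.succ_eq_add_one, ← h]
  ring

theorem two_dvd_factorial_div {k : ℕ} (hk : k ≠ 0) : 2 ∣ (3 * k)! / k ! ^ 3 := by
  rw [factorial_div_pow_three]
  exact (two_dvd_choose_two_mul hk).mul_left _

theorem three_dvd_factorial_div {k : ℕ} (hk : k ≠ 0) : 3 ∣ (3 * k)! / k ! ^ 3 := by
  rw [factorial_div_pow_three]
  exact (three_dvd_choose_three_mul hk).mul_right _

theorem seqF_cast {d : ℕ} (hd : ∀ k, k ≠ 0 → d ∣ (3 * k)! / k ! ^ 3) (n : ℕ) :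
    (seqF n : ZMod d) = 3 ^ n := by
  rw [seqF, Finset.sum_range_succ']
  push_cast [-Int.natCast_ediv, -Nat.cast_pow]
  rw [Finset.sum_eq_zero]
  · simp
  · intro k _
    rw [(ZMod.natCast_eq_zero_iff _ _).2 (hd (k + 1) k.succ_ne_zero), mul_zero]

theorem seqDelta_cast {d : ℕ} (hd : ∀ k, k ≠ 0 → d ∣ (3 * k)! / k ! ^ 3) (n : ℕ) :
    (seqDelta n : ZMod d) = 3 ^ n := by
  rw [seqDelta, Finset.sum_range_succ']
  push_cast [-Int.natCast_ediv, -Nat.cast_pow]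
  rw [Finset.sum_eq_zero]
  · simp
  · intro k _
    rw [(ZMod.natCast_eq_zero_iff _ _).2 (hd (k + 1) k.succ_ne_zero), mul_zero]

theorem seqG_cast_two {n : ℕ} (hn : 1 ≤ n) : (seqG n : ZMod 2) = 0 := by
  have h8 : (8 : ZMod 2) = 0 := by decide
  have h2 : (2 : ZMod 2) = 0 := by decide
  rw [seqG]
  push_cast
  refine Finset.sum_eq_zero fun k hk => ?_
  rcases Nat.lt_or_ge k n with h | h
  · refine Finset.sum_eq_zero fun l _ => ?_
    rw [h8, zero_pow (by omega)]
    simp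
  · obtain rfl : k = n := by have := Finset.mem_range.1 hk; omega
    rw [← Finset.mul_sum]
    have h3 : ∀ x : ZMod 2, x ^ 3 = x := by decide
    simp only [h3]
    have := Nat.sum_range_choose k
    rw [← Nat.cast_sum, this, Nat.cast_pow, Nat.cast_ofNat, h2, zero_pow (by omega), mul_zero]

/-- Since `8 = -1` and `x ^ 3 = x`, the sum becomes `(-1) ^ n * (1 + 2) ^ n`. -/
theorem seqG_cast_three {n : ℕ} (hn : 1 ≤ n) : (seqG n : ZMod 3) = 0 := by
  have h8 : (8 : ZMod 3) = -1 := by decide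
  have h3 : ∀ x : ZMod 3, x ^ 3 = x := by decide
  have hz : (1 + 2 : ZMod 3) = 0 := by decide
  rw [seqG]
  push_cast
  have h : ∀ k ∈ Finset.range (n + 1), ∑ l ∈ Finset.range (k + 1),
      ((-1) ^ k * 8 ^ (n - k) * (n.choose k) * (k.choose l) ^ 3 : ZMod 3) =
      (-1) ^ n * (1 ^ (n - k) * 2 ^ k * n.choose k) := fun k hk => by
    have hk : k + (n - k) = n := by have := Finset.mem_range.1 hk; omega
    rw [← Finset.mul_sum, h8, ← pow_add, hk]
    simp only [h3]
    rw [← Nat.cast_sum, Nat.sum_range_choose]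
    push_cast
    ring
  rw [Finset.sum_congr rfl h, ← Finset.mul_sum]
  have hb := add_pow (2 : ZMod 3) 1 n
  rw [add_comm 2 1, hz, zero_pow (by omega)] at hb
  rw [Finset.sum_congr rfl fun k _ => by rw [mul_comm (1 ^ (n - k)) (2 ^ k : ZMod 3)], ← hb,
    mul_zero]

end FactorialSums

/-! ### Sequences `s₁₈` and (η) -/

section PairedBinomials

variable {p : ℕ} [hp : Fact p.Prime]

theorem choose_mul_mul_cast (n k : ℕ) : ((p * n).choose (p * k) : ZMod p) = n.choose k := by
  simpa using choose_lucas hp.out.pos hp.out.pos n k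

theorem choose_mul_pred_mul_cast (n k : ℕ) :
    ((p * n - 1).choose (p * k) : ZMod p) = (n - 1).choose k := by
  have h1 := hp.out.pos
  rcases n with _ | n
  · simpa using choose_mul_mul_cast (p := p) 0 k
  · have h := choose_lucas (Nat.sub_lt h1 one_pos) h1 n k
    rw [add_zero, Nat.choose_zero_right, Nat.cast_one, mul_one] at h
    rw [mul_add, mul_one, show p * n + p - 1 = p * n + (p - 1) by omega, h, Nat.add_sub_cancel]

/-- Multiplying by `m` turns the sum into `(2 * m - j) * m.choose j`. -/
theorem choose_pred_add_choose_cast {m j : ℕ} (hm : (m : ZMod p) ≠ 0) (h : (2 * m : ZMod p) = j) :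
    ((m - 1).choose j + m.choose j : ZMod p) = 0 := by
  rcases m with _ | m
  · simp at hm
  refine (mul_eq_zero.1 ?_).resolve_left hm
  rcases Nat.lt_or_ge (m + 1) j with h1 | h1
  · simp [Nat.choose_eq_zero_of_lt h1, Nat.choose_eq_zero_of_lt (Nat.lt_of_succ_lt h1)]
  have h2 := congrArg (Nat.cast (R := ZMod p)) (Nat.choose_mul_succ_eq m j)
  push_cast [Nat.cast_sub h1] at h2 h ⊢
  rw [mul_add, mul_comm _ (m.choose j : ZMod p), h2, ← h]
  ring

theorem sum_range_choose_mul (f : ℕ → ZMod p) (n : ℕ) :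
    ∑ k ∈ Finset.range (p * n + 1), ((p * n).choose k : ZMod p) * f k =
      ∑ k ∈ Finset.range (n + 1), (n.choose k : ZMod p) * f (p * k) := by
  have hp0 := hp.out.pos
  have h1 : p * n + 1 ≤ p * (n + 1) := by rw [mul_add]; omega
  rw [← sum_range_eq_of_le h1 fun k hk => by
    simp [Nat.choose_eq_zero_of_lt (Nat.lt_of_succ_le hk)], sum_range_mul_eq]
  refine Finset.sum_congr rfl fun k _ => ?_
  rw [Finset.sum_eq_single_of_mem 0 (Finset.mem_range.2 hp0) fun s hs hs0 => ?_]
  · rw [add_zero, choose_mul_mul_cast]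
  · have h := choose_lucas hp0 (Finset.mem_range.1 hs) n k
    rw [add_zero] at h
    rw [h, Nat.choose_eq_zero_of_lt (Nat.pos_of_ne_zero hs0)]
    simp

/-- If `p ∣ n`, only the `k` divisible by `p` survive, and they reproduce the sum for `n / p`. -/
theorem cast_eq_zero_of_sum {S : ℕ → ℤ} (f : ℕ → ℕ → ZMod p)
    (hS : ∀ n, 1 ≤ n → (S n : ZMod p) = ∑ k ∈ Finset.range (n + 1), n.choose k * f n k)
    (h0 : ∀ n k : ℕ, (n : ZMod p) ≠ 0 → f n k = 0)
    (hf : ∀ n k, f (p * n) (p * k) = f n k) {n : ℕ} (hn : 1 ≤ n) : (S n : ZMod p) = 0 := by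
  induction n using Nat.strong_induction_on with
  | _ n ih =>
    by_cases h : (n : ZMod p) = 0
    · obtain ⟨m, rfl⟩ := (ZMod.natCast_eq_zero_iff _ _).1 h
      have hm : 0 < m := Nat.pos_of_mul_pos_left hn
      rw [hS _ hn, sum_range_choose_mul]
      simp only [hf]
      rw [← hS m hm]
      exact ih m (lt_mul_of_one_lt_left hm hp.out.one_lt) hm
    · rw [hS n hn]
      exact Finset.sum_eq_zero fun k _ => by rw [h0 n k h, mul_zero]

theorem neg_one_pow_mul_cast (k : ℕ) : (-1 : ZMod p) ^ (p * k) = (-1) ^ k := by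
  rw [mul_comm, pow_mul, ZMod.pow_card]

theorem seqS18_eq_sum {n : ℕ} (hn : 1 ≤ n) :
    seqS18 n = ∑ k ∈ Finset.range (n + 1), (n.choose k : ℤ) *
      ((-1) ^ k * ((2 * k).choose k : ℤ) * ((2 * (n - k)).choose (n - k) : ℤ) *
        (((2 * n - 3 * k - 1).choose n : ℤ) + ((2 * n - 3 * k).choose n : ℤ))) := by
  rw [seqS18, if_neg (by omega)]
  rw [sum_range_eq_of_le (a := n / 3 + 1) (b := n + 1) (by omega) fun k hk => by
    rw [Nat.choose_eq_zero_of_lt (show 2 * n - 3 * k - 1 < n by omega),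
      Nat.choose_eq_zero_of_lt (show 2 * n - 3 * k < n by omega)]
    simp]
  exact Finset.sum_congr rfl fun k _ => by ring

theorem seqS18_cast_two {n : ℕ} (hn : 1 ≤ n) : (seqS18 n : ZMod 2) = 0 := by
  rw [seqS18_eq_sum hn]
  push_cast
  refine Finset.sum_eq_zero fun k hk => ?_
  by_cases h : k = 0
  · rw [(ZMod.natCast_eq_zero_iff _ 2).2 (two_dvd_choose_two_mul (show n - k ≠ 0 by omega))]
    simp
  · rw [(ZMod.natCast_eq_zero_iff _ 2).2 (two_dvd_choose_two_mul h)]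
    simp

theorem seqS18_cast_three {n : ℕ} (hn : 1 ≤ n) : (seqS18 n : ZMod 3) = 0 := by
  refine cast_eq_zero_of_sum (fun n k => (-1) ^ k * ((2 * k).choose k : ZMod 3) *
    ((2 * (n - k)).choose (n - k) : ZMod 3) *
    (((2 * n - 3 * k - 1).choose n : ZMod 3) + ((2 * n - 3 * k).choose n : ZMod 3)))
    (fun n hn => ?_) (fun n k h => ?_) (fun n k => ?_) hn
  · rw [seqS18_eq_sum hn]
    push_cast
    rfl
  · refine mul_eq_zero_of_right _ ?_
    have h3 : (3 : ZMod 3) = 0 := by decide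
    have h2 : (2 : ZMod 3) ≠ 0 := by decide
    -- Where the subtraction truncates, its cast is not the difference, but the binomials vanish
    -- anyway.
    rcases Nat.lt_or_ge (2 * n) (3 * k) with hk | hk
    · have hn : 0 < n := Nat.pos_of_ne_zero (by rintro rfl; simp at h)
      rw [Nat.choose_eq_zero_of_lt (show 2 * n - 3 * k - 1 < n by omega),
        Nat.choose_eq_zero_of_lt (show 2 * n - 3 * k < n by omega)]
      simp
    · refine choose_pred_add_choose_cast ?_ ?_ <;> push_cast [Nat.cast_sub hk] <;>
        rw [h3, zero_mul, sub_zero]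
      · exact mul_ne_zero h2 h
      · linear_combination (n : ZMod 3) * h3
  · have e1 : 2 * (3 * n) - 3 * (3 * k) = 3 * (2 * n - 3 * k) := by omega
    have e2 : 2 * (3 * n - 3 * k) = 3 * (2 * (n - k)) := by omega
    have e3 : 2 * (3 * k) = 3 * (2 * k) := by omega
    rw [e1, e2, e3, ← Nat.mul_sub, neg_one_pow_mul_cast, choose_mul_mul_cast,
      choose_mul_mul_cast, choose_mul_pred_mul_cast, choose_mul_mul_cast]

theorem seqEta_eq_sum {n : ℕ} (hn : 1 ≤ n) :
    seqEta n = ∑ k ∈ Finset.range (n + 1), (n.choose k : ℤ) *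
      ((-1) ^ k * (n.choose k : ℤ) ^ 2 *
        (((4 * n - 5 * k - 1).choose (3 * n) : ℤ) + ((4 * n - 5 * k).choose (3 * n) : ℤ))) := by
  rw [seqEta, if_neg (by omega)]
  rw [sum_range_eq_of_le (a := n / 5 + 1) (b := n + 1) (by omega) fun k hk => by
    rw [Nat.choose_eq_zero_of_lt (show 4 * n - 5 * k - 1 < 3 * n by omega),
      Nat.choose_eq_zero_of_lt (show 4 * n - 5 * k < 3 * n by omega)]
    simp]
  exact Finset.sum_congr rfl fun k _ => by ring

instance fact_prime_five : Fact (Nat.Prime 5) := ⟨Nat.prime_five⟩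

theorem seqEta_cast_five {n : ℕ} (hn : 1 ≤ n) : (seqEta n : ZMod 5) = 0 := by
  refine cast_eq_zero_of_sum (fun n k => (-1) ^ k * (n.choose k : ZMod 5) ^ 2 *
    (((4 * n - 5 * k - 1).choose (3 * n) : ZMod 5) + ((4 * n - 5 * k).choose (3 * n) : ZMod 5)))
    (fun n hn => ?_) (fun n k h => ?_) (fun n k => ?_) hn
  · rw [seqEta_eq_sum hn]
    push_cast
    rfl
  · refine mul_eq_zero_of_right _ ?_
    have h5 : (5 : ZMod 5) = 0 := by decide
    have h4 : (4 : ZMod 5) ≠ 0 := by decide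
    rcases Nat.lt_or_ge (4 * n) (5 * k) with hk | hk
    · have hn : 0 < n := Nat.pos_of_ne_zero (by rintro rfl; simp at h)
      rw [Nat.choose_eq_zero_of_lt (show 4 * n - 5 * k - 1 < 3 * n by omega),
        Nat.choose_eq_zero_of_lt (show 4 * n - 5 * k < 3 * n by omega)]
      simp
    · refine choose_pred_add_choose_cast ?_ ?_ <;> push_cast [Nat.cast_sub hk] <;>
        rw [h5, zero_mul, sub_zero]
      · exact mul_ne_zero h4 h
      · linear_combination (n : ZMod 5) * h5
  · have e1 : 4 * (5 * n) - 5 * (5 * k) = 5 * (4 * n - 5 * k) := by omega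
    have e2 : 3 * (5 * n) = 5 * (3 * n) := by omega
    rw [e1, e2, neg_one_pow_mul_cast, choose_mul_mul_cast, choose_mul_pred_mul_cast,
      choose_mul_mul_cast]

theorem seqEta_cast_two_eq_sum {n : ℕ} (hn : 1 ≤ n) :
    (seqEta n : ZMod 2) = ∑ k ∈ Finset.range (n + 1), (n.choose k : ZMod 2) *
      (((4 * n - 5 * k - 1).choose (3 * n) : ZMod 2) +
        ((4 * n - 5 * k).choose (3 * n) : ZMod 2)) := by
  have h1 : (-1 : ZMod 2) = 1 := by decide
  have h2 : ∀ x y : ZMod 2, x * (x ^ 2 * y) = x * y := by decide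
  rw [seqEta_eq_sum hn]
  push_cast
  simp only [h1, one_pow, one_mul, h2]

/-- With `u = 4n - 5k - 1`, Lucas kills the even tops and leaves `(u + 2).choose (3n + 1) + u.choose
(3n + 1)`. Two uses of Pascal's rule give the right side plus `2 * u.choose (3n + 1)`. -/
theorem choose_odd_pair_cast_two {n : ℕ} (hn : 1 ≤ n) (k : ℕ) :
    (((4 * (2 * n + 1) - 5 * (2 * k) - 1).choose (3 * (2 * n + 1)) : ZMod 2) +
        ((4 * (2 * n + 1) - 5 * (2 * k)).choose (3 * (2 * n + 1)) : ZMod 2)) +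
      (((4 * (2 * n + 1) - 5 * (2 * k + 1) - 1).choose (3 * (2 * n + 1)) : ZMod 2) +
        ((4 * (2 * n + 1) - 5 * (2 * k + 1)).choose (3 * (2 * n + 1)) : ZMod 2)) =
      ((4 * n - 5 * k - 1).choose (3 * n) : ZMod 2) +
        ((4 * n - 5 * k).choose (3 * n) : ZMod 2) := by
  have h2 : (2 : ZMod 2) = 0 := by decide
  rcases Nat.lt_or_ge (5 * k) (4 * n) with h | h
  · obtain ⟨u, hu⟩ := Nat.exists_eq_add_of_lt h
    rw [show 4 * (2 * n + 1) - 5 * (2 * k) - 1 = 2 * (u + 2) + 1 by omega,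
      show 4 * (2 * n + 1) - 5 * (2 * k) = 2 * (u + 3) + 0 by omega,
      show 4 * (2 * n + 1) - 5 * (2 * k + 1) - 1 = 2 * u + 0 by omega,
      show 4 * (2 * n + 1) - 5 * (2 * k + 1) = 2 * u + 1 by omega,
      show 4 * n - 5 * k - 1 = u by omega, show 4 * n - 5 * k = u + 1 by omega,
      show 3 * (2 * n + 1) = 2 * (3 * n + 1) + 1 by omega,
      choose_lucas one_lt_two one_lt_two, choose_lucas two_pos one_lt_two,
      choose_lucas one_lt_two one_lt_two, choose_lucas two_pos one_lt_two,
      Nat.choose_succ_succ (u + 1), Nat.choose_succ_succ u]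
    simp only [Nat.choose_self, Nat.choose_eq_zero_of_lt one_pos, Nat.succ_eq_add_one]
    push_cast
    linear_combination (u.choose (3 * n + 1) : ZMod 2) * h2
  · repeat rw [Nat.choose_eq_zero_of_lt (by omega)]
    simp

theorem seqEta_cast_two {n : ℕ} (hn : 1 ≤ n) : (seqEta n : ZMod 2) = 1 := by
  induction n using Nat.strong_induction_on with
  | _ n ih =>
    obtain ⟨m, rfl | rfl⟩ := Nat.even_or_odd' n
    · have hm : 1 ≤ m := by omega
      rw [← ih m (by omega) hm, seqEta_cast_two_eq_sum hn, sum_range_choose_mul,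
        seqEta_cast_two_eq_sum hm]
      refine Finset.sum_congr rfl fun k _ => ?_
      rw [show 4 * (2 * m) - 5 * (2 * k) = 2 * (4 * m - 5 * k) by omega,
        show 3 * (2 * m) = 2 * (3 * m) by omega, choose_mul_mul_cast, choose_mul_pred_mul_cast]
    -- For odd `n`, the terms `2k` and `2k + 1` share the factor `m.choose k` and merge into term
    -- `k` for `m`.
    · rcases Nat.eq_zero_or_pos m with rfl | hm
      · decide
      rw [← ih m (by omega) hm, seqEta_cast_two_eq_sum hn,
        show 2 * m + 1 + 1 = 2 * (m + 1) by ring, sum_range_mul_eq, seqEta_cast_two_eq_sum hm]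
      refine Finset.sum_congr rfl fun k _ => ?_
      rw [← choose_odd_pair_cast_two hm, Finset.sum_range_succ, Finset.sum_range_one,
        choose_lucas one_lt_two two_pos, choose_lucas one_lt_two one_lt_two]
      simp only [Nat.choose_self, Nat.choose_zero_right, add_zero, Nat.cast_one, mul_one]
      ring

end PairedBinomials

/-! ### Assembly by modulus -/

theorem seq_modEq_two (s : Label) {n : ℕ} (hn : 1 ≤ n) : seq s n ≡ seq s 1 [ZMOD 2] := by
  have lucas : ∀ {S : ℕ → ℤ}, IsLucas 2 S → S 0 = 1 → S n ≡ S 1 [ZMOD 2] := fun {S} h h0 => by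
    have hx : ∀ x : ZMod 2, x * x = x := by decide
    exact h.eq_one h0 (fun r h1 h2 => by rw [show r = 1 by omega]) (hx _) hn
  have const : ∀ {S : ℕ → ℤ} (c : ZMod 2), (∀ {m : ℕ}, 1 ≤ m → (S m : ZMod 2) = c) →
      S n ≡ S 1 [ZMOD 2] := fun {S} c h =>
    (ZMod.intCast_eq_intCast_iff _ _ 2).1 ((h hn).trans (h le_rfl).symm)
  have h3 : (3 : ZMod 2) = 1 := by decide
  cases s
  · exact lucas isLucas_seqA rfl
  · exact lucas isLucas_seqB rfl
  · exact lucas isLucas_seqC rfl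
  · exact lucas isLucas_seqD rfl
  · exact const 1 fun {m} _ =>
      (seqF_cast (fun _ => two_dvd_factorial_div) m).trans (by rw [h3, one_pow])
  · exact const 0 seqG_cast_two
  · exact const 1 fun {m} _ =>
      (seqDelta_cast (fun _ => two_dvd_factorial_div) m).trans (by rw [h3, one_pow])
  · exact const 1 seqEta_cast_two
  · exact lucas isLucas_seqAlpha rfl
  · exact lucas isLucas_seqEpsilon rfl
  · exact lucas isLucas_seqZeta rfl
  · exact lucas isLucas_seqGamma rfl
  · exact lucas isLucas_seqS7 rfl
  · exact lucas isLucas_seqS10 rfl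
  · exact const 0 seqS18_cast_two

theorem seq_modEq_three {s : Label}
    (hs : s = .c ∨ s = .f ∨ s = .g ∨ s = .delta ∨ s = .alpha ∨ s = .epsilon ∨ s = .zeta ∨
      s = .s18) {n : ℕ} (hn : 1 ≤ n) : seq s n ≡ seq s 1 [ZMOD 3] := by
  have lucas : ∀ {S : ℕ → ℤ}, IsLucas 3 S → S 0 = 1 → (S 2 : ZMod 3) = S 1 →
      (S 1 : ZMod 3) * S 1 = S 1 → S n ≡ S 1 [ZMOD 3] := fun {S} h h0 h2 h1 =>
    h.eq_one h0 (fun r hr hr0 => by interval_cases r <;> simp_all) h1 hn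
  have const : ∀ {S : ℕ → ℤ}, (∀ {m : ℕ}, 1 ≤ m → (S m : ZMod 3) = 0) →
      S n ≡ S 1 [ZMOD 3] := fun {S} h =>
    (ZMod.intCast_eq_intCast_iff _ _ 3).1 ((h hn).trans (h le_rfl).symm)
  have h3 : (3 : ZMod 3) = 0 := by decide
  rcases hs with rfl | rfl | rfl | rfl | rfl | rfl | rfl | rfl
  · exact lucas isLucas_seqC rfl (by decide) (by decide)
  · exact const fun {m} hm =>
      (seqF_cast (fun _ => three_dvd_factorial_div) m).trans (by rw [h3, zero_pow (by omega)])
  · exact const seqG_cast_three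
  · exact const fun {m} hm =>
      (seqDelta_cast (fun _ => three_dvd_factorial_div) m).trans (by rw [h3, zero_pow (by omega)])
  · exact lucas isLucas_seqAlpha rfl (by decide) (by decide)
  · exact lucas isLucas_seqEpsilon rfl (by decide) (by decide)
  · exact lucas isLucas_seqZeta rfl (by decide) (by decide)
  · exact const seqS18_cast_three

theorem seq_modEq_neg_one_pow {s : Label} (hs : s = .a ∨ s = .gamma) (n : ℕ) :
    seq s n ≡ (-1) ^ n [ZMOD 3] := by
  rcases hs with rfl | rfl
  · exact isLucas_seqA.eq_pow (p := 3) (-1) rfl (by decide) n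
  · exact isLucas_seqGamma.eq_pow (p := 3) (-1) rfl (by decide) n

theorem seqB_modEq_three_pow (n : ℕ) : seqB n ≡ 3 ^ n [ZMOD 5] :=
  isLucas_seqB.eq_pow (p := 5) 3 rfl (by decide) n

end AperyLike

theorem corollary5p2 :
    (∀ (s : AperyLike.Label) (n : ℕ), 1 ≤ n →
      AperyLike.seq s n ≡ AperyLike.seq s 1 [ZMOD 2]) ∧
    (∀ s : AperyLike.Label,
      (s = .c ∨ s = .f ∨ s = .g ∨ s = .delta ∨ s = .alpha ∨ s = .epsilon ∨ s = .zeta ∨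
        s = .s18) →
      ∀ n : ℕ, 1 ≤ n → AperyLike.seq s n ≡ AperyLike.seq s 1 [ZMOD 3]) ∧
    (∀ s : AperyLike.Label, (s = .a ∨ s = .gamma) →
      ∀ n : ℕ, AperyLike.seq s n ≡ (-1) ^ n [ZMOD 3]) ∧
    (∀ n : ℕ, AperyLike.seq .b n ≡ 3 ^ n [ZMOD 5]) ∧
    (∀ n : ℕ, 1 ≤ n → AperyLike.seq .eta n ≡ 0 [ZMOD 5]) := by
  exact ⟨fun s _ => AperyLike.seq_modEq_two s, fun _ hs _ => AperyLike.seq_modEq_three hs,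
    fun _ => AperyLike.seq_modEq_neg_one_pow, AperyLike.seqB_modEq_three_pow,
    fun _ hn => (ZMod.intCast_eq_intCast_iff _ 0 5).1
      ((AperyLike.seqEta_cast_five hn).trans Int.cast_zero.symm)⟩
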